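/- Let $0<\beta<2$ and let $X=\{X_t\}_{t\ge 0}$ be a real-valued symmetric $\beta$-stable Lévy process (that is, $X_0=0$ and $X$ has stationary independent increments and càdlàg paths), scaled so that $$\mathrm{E}\,e^{izX_t}=e^{-t|z|^\beta}\qquad\text{for all } t\ge 0,\ z\in\mathbb{R}.$$ For $\alpha>0$ define the set of tall peaks of $X$ by $$\mathcal{H}_X(\alpha):=\left\{t\ge \mathrm{e}:\ X_t\ge t^{1/\beta}(\log_2 t)^\alpha\right\}.$$ For $F\subseteq\mathbb{R}$ let $\mathrm{pix}(F):=\{k\in\mathbb{Z}: F\cap[k,k+1)\neq\varnothing\}$, and define the macroscopic Minkowski dimension of $F$ as $$\mathrm{Dim}_{\mathrm M}(F):=\limsup_{n\to\infty}\frac1n\,\log_2\Bigl(\max\bigl(\bigl|\mathrm{pix}(F)\cap[-2^n,2^n)\bigr|,\,2\bigr)\Bigr),$$ where $|\cdots|$ denotes cardinality. If $0<\alpha\le 1/\beta$, then $\mathrm{Dim}_{\mathrm M}(\mathcal{H}_X(\alpha))=1$ almost surely. -/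

import Mathlib

open MeasureTheory ProbabilityTheory Filter Topology
open scoped NNReal

/-- The pixelization of `F ⊆ ℝ`: the integers `k` such that `F` meets `[k, k + 1)`. -/
def pix (F : Set ℝ) : Set ℤ :=
  {k : ℤ | (F ∩ Set.Ico (k : ℝ) ((k : ℝ) + 1)).Nonempty}

/-- The integers in the half-open box `B(0; r) = [-r, r)`. -/
def intBox (r : ℝ) : Set ℤ :=
  {k : ℤ | (k : ℝ) ∈ Set.Ico (-r) r}

/-- `Log₊ y = log₂ (max (y, 2))`. -/
noncomputable def logPlus (y : ℝ) : ℝ := Real.logb 2 (max y 2)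

/-- The macroscopic Minkowski dimension of `F ⊆ ℝ`,
`limsup_{n → ∞} n⁻¹ Log₊ |pix(F) ∩ B(0; 2ⁿ)|`, as an extended real number.
(The sets that are counted are finite, so `Set.ncard` is their cardinality.) -/
noncomputable def macroMinkowskiDim (F : Set ℝ) : EReal :=
  limsup (fun n : ℕ =>
    (((n : ℝ)⁻¹ * logPlus ((pix F ∩ intBox ((2 : ℝ) ^ n)).ncard : ℝ) : ℝ) : EReal)) atTop

/-- A path `[0, ∞) → ℝ` is càdlàg: right-continuous with finite left limits.
(At `t = 0` the left-limit clause is void, as `𝓝[<] 0 = ⊥` in `ℝ≥0`.) -/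
def IsCadlagPath (f : ℝ≥0 → ℝ) : Prop :=
  ∀ t : ℝ≥0, ContinuousWithinAt f (Set.Ici t) t ∧ ∃ l : ℝ, Tendsto f (𝓝[<] t) (𝓝 l)

/-- `X` is a real-valued Lévy process under `P`: it starts at `0`, has independent and
stationary increments, and has càdlàg paths (almost surely). -/
structure IsLevyProcess {Ω : Type*} [MeasurableSpace Ω] (X : ℝ≥0 → Ω → ℝ) (P : Measure Ω) :
    Prop where
  measurable : ∀ t, Measurable (X t)
  zero : ∀ᵐ ω ∂P, X 0 ω = 0
  indep : HasIndepIncrements X P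
  stationary : ∀ s t : ℝ≥0, IdentDistrib (fun ω => X (s + t) ω - X s ω) (X t) P P
  cadlag : ∀ᵐ ω ∂P, IsCadlagPath (fun t => X t ω)

/-- `X` is a symmetric `β`-stable Lévy process, scaled so that
`E exp(i z X_t) = exp(-t |z|^β)` for all `t ≥ 0` and `z ∈ ℝ`. -/
structure IsSymmetricStableProcess {Ω : Type*} [MeasurableSpace Ω] (β : ℝ)
    (X : ℝ≥0 → Ω → ℝ) (P : Measure Ω) : Prop extends IsLevyProcess X P where
  charFun_eq : ∀ (t : ℝ≥0) (z : ℝ),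
    ∫ ω, Complex.exp (Complex.I * (z : ℂ) * (X t ω : ℂ)) ∂P
      = ((Real.exp (-((t : ℝ) * |z| ^ β)) : ℝ) : ℂ)

/-- The set of tall peaks `{t ≥ e : x_t ≥ t^{1/β} (log₂ t)^α}` of a path `x`. -/
def tallPeaks (β α : ℝ) (x : ℝ≥0 → ℝ) : Set ℝ :=
  {t : ℝ | Real.exp 1 ≤ t ∧ t ^ (1 / β) * (Real.logb 2 t) ^ α ≤ x t.toNNReal}

/-!
The dimension of any set is at most one, because `[-2 ^ n, 2 ^ n)` contains `2 ^ (n + 1)` integers.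
For the lower bound the tall peaks are produced by single large increments. A stable variable
`X t` exceeds `r` with probability of order `t / r ^ β` (`stable_tail_le`,
`exists_stable_tail_ge`, both read off from the characteristic function). Hence between time
`2 ^ peakExp (j - 1)` and time `T = 2 ^ peakExp j` the process climbs by three times
`peakLevel β j`, which is of order `(T log₂ T) ^ (1 / β)`, with probability of order
`1 / peakExp j`. As `peakExp j` is about `j log₂ j`, these probabilities have infinite sum, and the
second Borel–Cantelli lemma shows that infinitely many climbs occur
(`IsSymmetricStableProcess.ae_frequently_climb`).

Two unfavourable events have summable probabilities, so they occur only finitely often: being below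
`-peakLevel β j` at the earlier time `2 ^ peakExp (j - 1)`, which is at most `T / j`
(`IsSymmetricStableProcess.ae_eventually_past`), and falling by more than one level below `X T` at
half or more of the integer times in the window `[T, T + T / 2 ^ peakGap j)`
(`IsSymmetricStableProcess.ae_eventually_stay`). The last event concerns the number of bad times
only, so Markov's inequality suffices and no maximal inequality is needed. At scales where the
climb occurs and neither unfavourable event does, at least half of the integer times of the window
are tall peaks (`le_ncard_pix_tallPeaks`). Since `2 ^ peakGap j` is of order `j`, which is
negligible on the logarithmic scale, the dimension is at least one (`one_le_macroMinkowskiDim`).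
-/

/-! ### Tails of symmetric stable laws -/

section Tails

variable {μ : Measure ℝ} [IsProbabilityMeasure μ] {β t : ℝ}

lemma stable_tail_le (hβ : 0 < β) (ht : 0 ≤ t)
    (h : ∀ z, charFun μ z = (Real.exp (-(t * |z| ^ β)) : ℝ)) {r : ℝ} (hr : 0 < r) :
    μ.real {x | r < |x|} ≤ 2 * 2 ^ β * t / r ^ β := by
  have hbound : ∀ z ∈ Set.uIoc (-2 * r⁻¹) (2 * r⁻¹), ‖1 - charFun μ z‖ ≤ t * (2 * r⁻¹) ^ β := by
    intro z hz
    rw [Set.uIoc_of_le (by nlinarith [inv_pos.2 hr])] at hz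
    have hz' : |z| ≤ 2 * r⁻¹ := abs_le.2 ⟨by linarith [hz.1], hz.2⟩
    have h0 : 0 ≤ t * |z| ^ β := mul_nonneg ht (Real.rpow_nonneg (abs_nonneg _) _)
    have h1 : t * |z| ^ β ≤ t * (2 * r⁻¹) ^ β := by gcongr
    rw [h z, ← Complex.ofReal_one, ← Complex.ofReal_sub, Complex.norm_real, Real.norm_eq_abs,
      abs_of_nonneg (by linarith [Real.exp_le_one_iff.2 (neg_nonpos.2 h0)])]
    linarith [Real.add_one_le_exp (-(t * |z| ^ β))]
  refine (measureReal_abs_gt_le_integral_charFun hr).trans ?_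
  refine (mul_le_mul_of_nonneg_left (intervalIntegral.norm_integral_le_of_norm_le_const hbound)
    (by positivity)).trans_eq ?_
  rw [abs_of_nonneg (by nlinarith [inv_pos.2 hr]), Real.mul_rpow (by norm_num) (by positivity),
    Real.inv_rpow hr.le]
  field_simp
  norm_num
  ring

lemma integral_cos_eq_of_charFun
    (h : ∀ z, charFun μ z = (Real.exp (-(t * |z| ^ β)) : ℝ)) (z : ℝ) :
    ∫ x, Real.cos (z * x) ∂μ = Real.exp (-(t * |z| ^ β)) := by
  have h1 := h z
  rw [charFun_apply_real] at h1
  have hint : Integrable (fun x : ℝ => Complex.exp (z * x * Complex.I)) μ := by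
    refine Integrable.of_bound (by fun_prop) 1 (ae_of_all _ fun x => ?_)
    rw [← Complex.ofReal_mul, Complex.norm_exp_ofReal_mul_I]
  have h2 := Complex.reCLM.integral_comp_comm hint
  rw [h1, Complex.reCLM_apply, Complex.ofReal_re] at h2
  simpa [← Complex.ofReal_mul, Complex.exp_ofReal_mul_I_re] using h2

/-- The integral of `q (1 - cos (z x)) - (1 - cos (2 z x))` against the law is read off from the
characteristic function and is of order `t z ^ β` as soon as `2 ^ β < q`, whereas the integrand is
nonpositive near the origin as soon as `q < 4`. Hence the mass far from the origin cannot be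
small. This is the only place where `β < 2` is needed. -/
lemma exists_stable_tail_ge (hβ₂ : β < 2) :
    ∃ c > 0, ∃ K > 0, ∀ (μ : Measure ℝ) [IsProbabilityMeasure μ] (t : ℝ), 0 ≤ t →
      (∀ z, charFun μ z = (Real.exp (-(t * |z| ^ β)) : ℝ)) →
      ∀ r > 0, K * t ≤ r ^ β → c * t / r ^ β ≤ μ.real {x | r < |x|} := by
  have hb4 : (2 : ℝ) ^ β < 4 := by
    calc (2 : ℝ) ^ β < 2 ^ (2 : ℝ) := Real.rpow_lt_rpow_of_exponent_lt (by norm_num) hβ₂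
      _ = 4 := by norm_num
  have hb0 : (0 : ℝ) < 2 ^ β := by positivity
  obtain ⟨q, hq₁, hq₂⟩ := exists_between hb4
  -- With this `δ`, `|θ| ≤ δ` forces `1 + cos θ ≥ q / 2`.
  set δ := √(4 - q) with hδ
  have hδ0 : 0 < δ := Real.sqrt_pos.2 (by linarith)
  have hδ2 : δ ^ 2 = 4 - q := Real.sq_sqrt (by linarith)
  have hδβ : 0 < δ ^ β := Real.rpow_pos_of_pos hδ0 _
  have hqb : 0 < q - 2 ^ β := by linarith
  have hq0 : 0 < q := by linarith
  refine ⟨δ ^ β * (q - 2 ^ β) / 16, by positivity, 2 * q * δ ^ β / (q - 2 ^ β), by positivity, ?_⟩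
  intro μ _ t ht h r hr hK
  have hrβ : 0 < r ^ β := Real.rpow_pos_of_pos hr _
  set z := δ / r with hz
  have hz0 : 0 < z := by positivity
  set s := t * z ^ β with hs
  have hs_eq : s = t * δ ^ β / r ^ β := by
    rw [hs, hz, Real.div_rpow hδ0.le hr.le]; ring
  have hs0 : 0 ≤ s := by positivity
  have hqs : q * s ≤ (q - 2 ^ β) / 2 := by
    rw [hs_eq, ← mul_div_assoc, div_le_iff₀ hrβ]
    rw [div_mul_eq_mul_div, div_le_iff₀ hqb] at hK
    linarith
  have hI₁ : Integrable (fun x : ℝ => Real.cos (z * x)) μ :=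
    Integrable.of_bound (by fun_prop) 1 (ae_of_all _ fun x => Real.abs_cos_le_one _)
  have hI₂ : Integrable (fun x : ℝ => Real.cos (2 * z * x)) μ :=
    Integrable.of_bound (by fun_prop) 1 (ae_of_all _ fun x => Real.abs_cos_le_one _)
  have hJ₁ : Integrable (fun x : ℝ => 1 - Real.cos (z * x)) μ := (integrable_const 1).sub hI₁
  have hJ₂ : Integrable (fun x : ℝ => 1 - Real.cos (2 * z * x)) μ := (integrable_const 1).sub hI₂
  have hmeas : MeasurableSet {x : ℝ | r < |x|} := measurableSet_lt measurable_const (by fun_prop)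
  -- The test function is at most `8` times the indicator of the tail.
  have hle : ∫ x, (q * (1 - Real.cos (z * x)) - (1 - Real.cos (2 * z * x))) ∂μ
      ≤ ∫ x, {x : ℝ | r < |x|}.indicator (fun _ => (8 : ℝ)) x ∂μ := by
    refine integral_mono ?_ ((integrable_const _).indicator hmeas) fun x => ?_
    · exact (hJ₁.const_mul q).sub hJ₂
    · have hcos : Real.cos (2 * z * x) = 2 * Real.cos (z * x) ^ 2 - 1 := by
        rw [mul_assoc, Real.cos_two_mul]
      have hc1 := Real.cos_le_one (z * x)
      have hc2 := Real.neg_one_le_cos (z * x)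
      by_cases hx : r < |x|
      · simp only [Set.indicator, Set.mem_ofPred_eq, hx, if_true, hcos]
        nlinarith
      · simp only [Set.indicator, Set.mem_ofPred_eq, hx, if_false, hcos]
        have hzx : (z * x) ^ 2 ≤ 4 - q := by
          rw [← hδ2, sq_le_sq, abs_mul, abs_of_pos hz0, abs_of_pos hδ0]
          calc z * |x| ≤ z * r := by gcongr; exact not_lt.1 hx
            _ = δ := by rw [hz]; field_simp
        have := Real.one_sub_sq_div_two_le_cos (x := z * x)
        nlinarith
  have hval : ∫ x, (q * (1 - Real.cos (z * x)) - (1 - Real.cos (2 * z * x))) ∂μ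
      = q * (1 - Real.exp (-s)) - (1 - Real.exp (-(2 ^ β * s))) := by
    rw [integral_sub (hJ₁.const_mul q) hJ₂,
      integral_const_mul, integral_sub (integrable_const 1) hI₁,
      integral_sub (integrable_const 1) hI₂, integral_cos_eq_of_charFun h,
      integral_cos_eq_of_charFun h, abs_of_pos hz0, abs_of_pos (by positivity),
      Real.mul_rpow (by norm_num) hz0.le]
    simp only [integral_const, probReal_univ, smul_eq_mul, mul_one, hs]
    ring_nf
  rw [hval, integral_indicator hmeas, setIntegral_const, smul_eq_mul] at hle
  have he₂ : 1 - Real.exp (-(2 ^ β * s)) ≤ 2 ^ β * s := by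
    linarith [Real.add_one_le_exp (-(2 ^ β * s))]
  -- This follows from `exp (-s) ≤ 1 / (1 + s)`.
  have he₁ : s * (1 - s) ≤ 1 - Real.exp (-s) := by
    have h1 := Real.add_one_le_exp s
    have h2 : Real.exp (-s) * Real.exp s = 1 := by rw [← Real.exp_add]; simp
    have h3 : Real.exp (-s) * (1 + s) ≤ 1 := by nlinarith [Real.exp_pos (-s)]
    have h4 : Real.exp (-s) ≤ 1 / (1 + s) := by rwa [le_div_iff₀ (by linarith)]
    have h5 : 1 / (1 + s) ≤ 1 - s * (1 - s) := by
      rw [div_le_iff₀ (by linarith)]; nlinarith [pow_nonneg hs0 3]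
    linarith
  have hgoal : δ ^ β * (q - 2 ^ β) / 16 * t / r ^ β = s * (q - 2 ^ β) / 16 := by
    rw [hs_eq]; ring
  rw [hgoal]
  nlinarith [mul_le_mul_of_nonneg_left he₁ hq0.le, mul_le_mul_of_nonneg_left hqs hs0]

lemma two_mul_stable_tail (h : ∀ z, charFun μ z = (Real.exp (-(t * |z| ^ β)) : ℝ)) {r : ℝ}
    (hr : 0 ≤ r) : μ.real {x | r < |x|} = 2 * μ.real {x | r < x} := by
  have hmap : μ.map (fun x => -x) = μ := by
    have : IsProbabilityMeasure (μ.map (fun x => -x)) :=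
      Measure.isProbabilityMeasure_map (by fun_prop)
    refine Measure.ext_of_charFun (funext fun z => ?_)
    have h1 := charFun_map_mul (μ := μ) (-1) z
    simp only [neg_mul, one_mul] at h1
    rw [h1, h, h, abs_neg]
  have hm : MeasurableSet {x : ℝ | r < x} := measurableSet_Ioi
  have hneg : μ.real {x | r < -x} = μ.real {x | r < x} := by
    conv_rhs => rw [← hmap, map_measureReal_apply (by fun_prop) hm]
    rfl
  have hU : {x : ℝ | r < |x|} = {x | r < x} ∪ {x | r < -x} := by
    ext x; simp [lt_abs]
  rw [hU, measureReal_union _ (measurableSet_lt measurable_const (by fun_prop)), hneg, two_mul]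
  refine Set.disjoint_left.2 fun x (hx : r < x) (hx' : r < -x) => ?_
  linarith

end Tails

/-! ### Tails of the increments of the process -/

section Increments

variable {Ω : Type*} [MeasurableSpace Ω] {P : Measure Ω} {β : ℝ} {X : ℝ≥0 → Ω → ℝ}

lemma IsSymmetricStableProcess.charFun_map (hX : IsSymmetricStableProcess β X P) (t : ℝ≥0)
    (z : ℝ) : charFun (P.map (X t)) z = (Real.exp (-((t : ℝ) * |z| ^ β)) : ℝ) := by
  rw [charFun_apply_real, integral_map (hX.measurable t).aemeasurable
    (Continuous.aestronglyMeasurable (by fun_prop)), ← hX.charFun_eq t z]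
  congr with ω
  ring_nf

variable [IsProbabilityMeasure P]

lemma IsSymmetricStableProcess.measureReal_lt_neg_le (hX : IsSymmetricStableProcess β X P)
    (hβ : 0 < β) (t : ℝ≥0) {r : ℝ} (hr : 0 < r) :
    P.real {ω | X t ω < -r} ≤ 2 * 2 ^ β * t / r ^ β := by
  have : IsProbabilityMeasure (P.map (X t)) :=
    Measure.isProbabilityMeasure_map (hX.measurable t).aemeasurable
  refine le_trans ?_ (stable_tail_le hβ t.coe_nonneg (hX.charFun_map t) hr)
  rw [map_measureReal_apply (hX.measurable t) (measurableSet_lt measurable_const (by fun_prop))]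
  exact measureReal_mono fun ω (hω : X t ω < -r) => lt_abs.2 (Or.inr (lt_neg_of_lt_neg hω))

lemma IsSymmetricStableProcess.measureReal_increment_lt_neg_le
    (hX : IsSymmetricStableProcess β X P) (hβ : 0 < β) (s t : ℝ≥0) {r : ℝ} (hr : 0 < r) :
    P.real {ω | X (s + t) ω - X s ω < -r} ≤ 2 * 2 ^ β * t / r ^ β := by
  refine le_trans (le_of_eq ?_) (hX.measureReal_lt_neg_le hβ t hr)
  exact congrArg ENNReal.toReal ((hX.stationary s t).measure_mem_eq measurableSet_Iio)

lemma IsSymmetricStableProcess.exists_le_measureReal_lt_increment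
    (hX : IsSymmetricStableProcess β X P) (hβ₂ : β < 2) :
    ∃ c > 0, ∃ K > 0, ∀ (s t : ℝ≥0) (r : ℝ), 0 < r → K * t ≤ r ^ β →
      c * t / r ^ β ≤ P.real {ω | r < X (s + t) ω - X s ω} := by
  obtain ⟨c, hc, K, hK, h⟩ := exists_stable_tail_ge hβ₂
  refine ⟨c / 2, by positivity, K, hK, fun s t r hr ht => ?_⟩
  have : IsProbabilityMeasure (P.map (X t)) :=
    Measure.isProbabilityMeasure_map (hX.measurable t).aemeasurable
  have h1 := h (P.map (X t)) t t.coe_nonneg (hX.charFun_map t) r hr ht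
  rw [two_mul_stable_tail (hX.charFun_map t) hr.le,
    map_measureReal_apply (hX.measurable t) (s := {x | r < x}) measurableSet_Ioi] at h1
  have h2 : P.real {ω | r < X (s + t) ω - X s ω} = P.real (X t ⁻¹' {x | r < x}) :=
    congrArg ENNReal.toReal ((hX.stationary s t).measure_mem_eq measurableSet_Ioi)
  rw [h2]
  calc c / 2 * t / r ^ β = (c * t / r ^ β) / 2 := by ring
    _ ≤ _ := by linarith

/-- If each of finitely many events has probability at most `p`, then by Markov's inequality at
least half of them occur simultaneously with probability at most `2 p`. -/
lemma measureReal_half_le_card_le {ι : Type*} (s : Finset ι) (hs : s.Nonempty) {E : ι → Set Ω}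
    [∀ i, DecidablePred (· ∈ E i)] (hE : ∀ i ∈ s, MeasurableSet (E i)) {p : ℝ}
    (hp : ∀ i ∈ s, P.real (E i) ≤ p) :
    P.real {ω | (s.card : ℝ) / 2 ≤ (s.filter fun i => ω ∈ E i).card} ≤ 2 * p := by
  have hcard : (0 : ℝ) < s.card := by exact_mod_cast hs.card_pos
  have hf : ∀ ω, ((s.filter fun i => ω ∈ E i).card : ℝ)
      = ∑ i ∈ s, (E i).indicator (fun _ => (1 : ℝ)) ω := by
    intro ω
    rw [Finset.card_filter]
    push_cast
    exact Finset.sum_congr rfl fun i _ => by simp [Set.indicator]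
  have hint : ∀ i ∈ s, Integrable ((E i).indicator fun _ => (1 : ℝ)) P :=
    fun i hi => (integrable_const _).indicator (hE i hi)
  have h1 := mul_meas_ge_le_integral_of_nonneg (μ := P)
    (f := fun ω => ∑ i ∈ s, (E i).indicator (fun _ => (1 : ℝ)) ω)
    (ae_of_all _ fun ω => Finset.sum_nonneg fun i _ =>
      Set.indicator_nonneg (fun _ _ => zero_le_one) _)
    (integrable_finsetSum s hint) ((s.card : ℝ) / 2)
  rw [integral_finsetSum s hint] at h1
  have h2 : ∑ i ∈ s, ∫ ω, (E i).indicator (fun _ => (1 : ℝ)) ω ∂P ≤ s.card * p := by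
    rw [← nsmul_eq_mul]
    refine Finset.sum_le_card_nsmul s _ p fun i hi => ?_
    rw [integral_indicator (hE i hi), setIntegral_const, smul_eq_mul, mul_one]
    exact hp i hi
  simp only [hf]
  have h3 := h1.trans h2
  rw [div_mul_eq_mul_div, mul_comm, div_le_iff₀ two_pos] at h3
  nlinarith

end Increments

/-! ### The time scales -/

/-- The number of dyadic scales separating consecutive members of the sequence of times
`2 ^ peakExp j`. -/
def peakGap (j : ℕ) : ℕ := Nat.log 2 j + 1

/-- The exponents of the times `2 ^ peakExp j` near which tall peaks are looked for. They grow
like `j log₂ j`: fast enough for the past to be negligible at each of them, slowly enough for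
`∑ 1 / peakExp j` to diverge. -/
def peakExp (j : ℕ) : ℕ := j * peakGap j

/-- A height that exceeds `t ^ (1 / β) * (log₂ t) ^ (1 / β)` for all times
`t ≤ 2 * 2 ^ peakExp j`. -/
noncomputable def peakLevel (β : ℝ) (j : ℕ) : ℝ :=
  (2 * 2 ^ peakExp j * ((peakExp j : ℝ) + 1)) ^ (1 / β)

lemma one_le_peakGap (j : ℕ) : 1 ≤ peakGap j := Nat.le_add_left _ _

lemma peakGap_mono : Monotone peakGap := fun _ _ h => Nat.add_le_add_right (Nat.log_mono_right h) 1

lemma le_peakExp (j : ℕ) : j ≤ peakExp j := Nat.le_mul_of_pos_right j (one_le_peakGap j)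

lemma le_two_pow_peakGap (j : ℕ) : j ≤ 2 ^ peakGap j := (Nat.lt_pow_succ_log_self one_lt_two j).le

lemma peakExp_add_peakGap_le (j : ℕ) : peakExp j + peakGap (j + 1) ≤ peakExp (j + 1) := by
  have := Nat.mul_le_mul_left j (peakGap_mono j.le_succ)
  unfold peakExp
  rw [Nat.succ_eq_add_one] at this
  linarith [add_mul j 1 (peakGap (j + 1))]

lemma peakExp_mono : Monotone peakExp :=
  monotone_nat_of_le_succ fun j => le_of_add_le_left (peakExp_add_peakGap_le j)

lemma peakGap_le_peakExp {j : ℕ} (hj : 1 ≤ j) : peakGap j ≤ peakExp j :=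
  Nat.le_mul_of_pos_left _ hj

lemma tendsto_peakExp : Tendsto peakExp atTop atTop :=
  tendsto_atTop_mono le_peakExp tendsto_id

lemma peakLevel_pos (β : ℝ) (j : ℕ) : 0 < peakLevel β j := by
  unfold peakLevel; positivity

lemma peakLevel_rpow {β : ℝ} (hβ : 0 < β) (j : ℕ) :
    peakLevel β j ^ β = 2 * 2 ^ peakExp j * ((peakExp j : ℝ) + 1) := by
  rw [peakLevel, ← Real.rpow_mul (by positivity), one_div_mul_cancel hβ.ne', Real.rpow_one]

lemma not_summable_one_div_peakExp : ¬ Summable fun j : ℕ => 1 / (peakExp j : ℝ) := by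
  rw [← summable_condensed_iff_of_nonneg (fun j => by positivity)]
  · have h : (fun k : ℕ => (2 : ℝ) ^ k * (1 / (peakExp (2 ^ k) : ℝ)))
        = fun k : ℕ => 1 / ((k + 1 : ℕ) : ℝ) := by
      funext k
      simp only [peakExp, peakGap, Nat.log_pow one_lt_two]
      push_cast
      field_simp
    rw [h, summable_nat_add_iff 1 (f := fun k : ℕ => 1 / (k : ℝ))]
    exact Real.not_summable_one_div_natCast
  · intro m n hm hmn
    have : 0 < peakExp m := hm.trans_le (le_peakExp m)
    gcongr
    exact peakExp_mono hmn

/-! ### Counting the pixels of tall peaks along a path -/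

lemma macroMinkowskiDim_le_one (F : Set ℝ) : macroMinkowskiDim F ≤ 1 := by
  have hlim : Tendsto (fun n : ℕ => ((1 + 1 / (n : ℝ) : ℝ) : EReal)) atTop (𝓝 1) := by
    have h := tendsto_one_div_atTop_nhds_zero_nat (𝕜 := ℝ) |>.const_add 1
    rw [add_zero] at h
    exact (continuous_coe_real_ereal.tendsto 1).comp h
  rw [← hlim.limsup_eq]
  refine limsup_le_limsup ?_
  filter_upwards [eventually_ge_atTop 1] with n hn
  have hn0 : (0 : ℝ) < n := by exact_mod_cast hn
  rw [EReal.coe_le_coe_iff]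
  have hcard : (pix F ∩ intBox ((2 : ℝ) ^ n)).ncard ≤ 2 ^ (n + 1) := by
    have hsub : pix F ∩ intBox ((2 : ℝ) ^ n) ⊆ Finset.Ico (-2 ^ n : ℤ) (2 ^ n) := by
      rintro k ⟨-, hk₁, hk₂⟩
      rw [Finset.coe_Ico]
      exact ⟨by exact_mod_cast hk₁, by exact_mod_cast hk₂⟩
    refine (Set.ncard_le_ncard hsub (Finset.finite_toSet _)).trans ?_
    rw [Set.ncard_coe_finset, Int.card_Ico, Int.toNat_le]
    push_cast
    linarith [pow_succ (2 : ℤ) n]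
  have hlog : logPlus ((pix F ∩ intBox ((2 : ℝ) ^ n)).ncard : ℝ) ≤ n + 1 := by
    have h2 : max ((pix F ∩ intBox ((2 : ℝ) ^ n)).ncard : ℝ) 2 ≤ 2 ^ (n + 1) := by
      refine max_le (by exact_mod_cast hcard) ?_
      calc (2 : ℝ) = 2 ^ 1 := (pow_one 2).symm
        _ ≤ 2 ^ (n + 1) := pow_le_pow_right₀ one_le_two (by omega)
    refine (Real.logb_le_logb_of_le one_lt_two (by positivity) h2).trans_eq ?_
    rw [Real.logb_pow, Real.logb_self_eq_one one_lt_two]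
    push_cast; ring
  calc (n : ℝ)⁻¹ * logPlus _ ≤ (n : ℝ)⁻¹ * (n + 1) := by gcongr
    _ = 1 + 1 / n := by field_simp

/-- If infinitely often a proportion `2 ^ (-peakGap j)` of the box of radius
`2 ^ (peakExp j + 1)` is occupied, up to a constant factor, the dimension is at least one, since
`peakGap j = o(peakExp j)`. -/
lemma one_le_macroMinkowskiDim {F : Set ℝ}
    (h : ∃ᶠ j in atTop, (2 : ℝ) ^ (peakExp j - peakGap j) / 2
      ≤ (pix F ∩ intBox ((2 : ℝ) ^ (peakExp j + 1))).ncard) :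
    1 ≤ macroMinkowskiDim F := by
  rw [← EReal.ge_of_forall_gt_iff_ge]
  intro r hr
  have hr1 : r < 1 := by exact_mod_cast hr
  refine le_limsup_of_frequently_le ?_
  have ht : Tendsto (fun j => peakExp j + 1) atTop atTop :=
    (tendsto_add_atTop_nat 1).comp tendsto_peakExp
  -- The `j`-th scale is seen by the box of radius `2 ^ n` with `n = peakExp j + 1`.
  refine ht.frequently ?_
  have hev : ∀ᶠ j : ℕ in atTop, 3 / (1 - r) ≤ j := tendsto_natCast_atTop_atTop.eventually_ge_atTop _
  refine (h.and_eventually (hev.and (eventually_ge_atTop 1))).mono ?_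
  rintro j ⟨hj, hjr, hj1⟩
  rw [EReal.coe_le_coe_iff]
  have hlog : (peakExp j : ℝ) - peakGap j - 1
      ≤ logPlus ((pix F ∩ intBox ((2 : ℝ) ^ (peakExp j + 1))).ncard : ℝ) := by
    have h1 := Real.logb_le_logb_of_le one_lt_two (by positivity) (hj.trans (le_max_left _ 2))
    refine le_trans (le_of_eq ?_) h1
    rw [Real.logb_div (by positivity) two_ne_zero, Real.logb_pow,
      Real.logb_self_eq_one one_lt_two, Nat.cast_sub (peakGap_le_peakExp hj1)]
    ring
  have hexp : (peakExp j : ℝ) = j * peakGap j := by simp [peakExp]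
  have hg : (1 : ℝ) ≤ peakGap j := by exact_mod_cast one_le_peakGap j
  rw [div_le_iff₀ (by linarith)] at hjr
  rw [← div_eq_inv_mul, le_div_iff₀ (by positivity)]
  push_cast
  have h2 : (peakGap j : ℝ) * 3 ≤ (1 - r) * (peakExp j + 1) := by
    rw [hexp]
    nlinarith
  linarith

lemma mem_tallPeaks_of_peakLevel_le {β α : ℝ} (hβ : 0 < β) (hα : α ≤ 1 / β) {x : ℝ≥0 → ℝ}
    {j : ℕ} (hj : 2 ≤ j) {t : ℝ≥0} (ht₁ : (2 : ℝ) ^ peakExp j ≤ t)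
    (ht₂ : (t : ℝ) ≤ 2 ^ (peakExp j + 1)) (hx : peakLevel β j ≤ x t) :
    (t : ℝ) ∈ tallPeaks β α x := by
  have h4 : (4 : ℝ) ≤ t := by
    refine le_trans ?_ ht₁
    calc (4 : ℝ) = 2 ^ 2 := by norm_num
      _ ≤ 2 ^ peakExp j := pow_le_pow_right₀ one_le_two (hj.trans (le_peakExp j))
  refine ⟨by linarith [Real.exp_one_lt_d9], ?_⟩
  rw [Real.toNNReal_coe]
  refine le_trans ?_ hx
  have hlog₁ : 1 ≤ Real.logb 2 t := by
    rw [Real.le_logb_iff_rpow_le one_lt_two (by linarith)]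
    norm_num; linarith
  have hlog₂ : Real.logb 2 t ≤ peakExp j + 1 := by
    rw [Real.logb_le_iff_le_rpow one_lt_two (by linarith)]
    exact_mod_cast ht₂
  rw [peakLevel, Real.mul_rpow (by positivity) (by positivity)]
  gcongr
  · rwa [pow_succ, mul_comm] at ht₂
  · calc Real.logb 2 t ^ α ≤ Real.logb 2 t ^ (1 / β) := Real.rpow_le_rpow_of_exponent_le hlog₁ hα
      _ ≤ _ := by gcongr

/-- A path that is not too low at time `2 ^ peakExp (j - 1)`, climbs by three levels until time
`2 ^ peakExp j`, and afterwards loses more than one level at fewer than half of the integer times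
of a window, has tall peaks at the remaining integer times of that window. -/
lemma le_ncard_pix_tallPeaks {β α : ℝ} (hβ : 0 < β) (hα : α ≤ 1 / β) {x : ℝ≥0 → ℝ} {j : ℕ}
    (hj : 2 ≤ j) {y : ℝ} (hy : -peakLevel β j ≤ y)
    (hclimb : 3 * peakLevel β j < x (2 ^ peakExp j) - y)
    (hstay : ((((Finset.range (2 ^ (peakExp j - peakGap j))).filter fun k : ℕ =>
      x (2 ^ peakExp j + k) - x (2 ^ peakExp j) < -peakLevel β j).card : ℕ) : ℝ)
        < (2 : ℝ) ^ (peakExp j - peakGap j) / 2) :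
    (2 : ℝ) ^ (peakExp j - peakGap j) / 2
      ≤ (pix (tallPeaks β α x) ∩ intBox ((2 : ℝ) ^ (peakExp j + 1))).ncard := by
  set L := 2 ^ (peakExp j - peakGap j) with hL
  set G := (Finset.range L).filter fun k : ℕ =>
      ¬ x (2 ^ peakExp j + k) - x (2 ^ peakExp j) < -peakLevel β j with hG
  have hLr : (L : ℝ) = 2 ^ (peakExp j - peakGap j) := by simp [hL]
  have hcard : (L : ℝ) / 2 ≤ G.card := by
    have h1 := Finset.card_filter_add_card_filter_not (s := Finset.range L) fun k : ℕ =>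
      x (2 ^ peakExp j + k) - x (2 ^ peakExp j) < -peakLevel β j
    rw [Finset.card_range] at h1
    have h2 : (((((Finset.range L).filter fun k : ℕ =>
      x (2 ^ peakExp j + k) - x (2 ^ peakExp j) < -peakLevel β j).card : ℕ) : ℝ) + G.card) = L := by
      rw [hG, ← Nat.cast_add, h1]
    linarith
  rw [hLr] at hcard
  refine hcard.trans ?_
  -- An integer time `m` of the window itself witnesses `m ∈ pix`.
  set f : ℕ → ℤ := fun k => 2 ^ peakExp j + k with hf
  have hinj : Function.Injective f := fun a b hab => by simpa [hf] using hab
  have hsub : ((G.image f : Finset ℤ) : Set ℤ)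
      ⊆ pix (tallPeaks β α x) ∩ intBox ((2 : ℝ) ^ (peakExp j + 1)) := by
    intro m hm
    obtain ⟨k, hk, rfl⟩ := Finset.mem_image.1 (Finset.mem_coe.1 hm)
    rw [hG, Finset.mem_filter, Finset.mem_range, not_lt] at hk
    have hkL : (k : ℝ) < 2 ^ peakExp j := by
      have : k < 2 ^ peakExp j :=
        hk.1.trans_le (Nat.pow_le_pow_right two_pos (Nat.sub_le _ _))
      exact_mod_cast this
    have hpow : (2 : ℝ) ^ (peakExp j + 1) = 2 ^ peakExp j + 2 ^ peakExp j := by ring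
    have hpos : (0 : ℝ) < 2 ^ peakExp j := by positivity
    have hk0 : (0 : ℝ) ≤ k := k.cast_nonneg
    have hcast : ((f k : ℤ) : ℝ) = ((2 ^ peakExp j + k : ℝ≥0) : ℝ) := by simp [hf]
    have hval : ((2 ^ peakExp j + k : ℝ≥0) : ℝ) = 2 ^ peakExp j + k := by simp
    refine ⟨⟨(f k : ℤ), ?_, ⟨le_rfl, by linarith⟩⟩, ⟨?_, ?_⟩⟩
    · rw [hcast]
      refine mem_tallPeaks_of_peakLevel_le hβ hα hj ?_ ?_ ?_
      · rw [hval]; linarith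
      · rw [hval]; linarith
      · linarith [hk.2]
    · rw [hcast, hval]; linarith
    · rw [hcast, hval]; linarith
  have hfin : (pix (tallPeaks β α x) ∩ intBox ((2 : ℝ) ^ (peakExp j + 1))).Finite := by
    refine (Set.finite_Ico (-2 ^ (peakExp j + 1) : ℤ) (2 ^ (peakExp j + 1))).subset ?_
    rintro k ⟨-, hk₁, hk₂⟩
    exact ⟨by exact_mod_cast hk₁, by exact_mod_cast hk₂⟩
  have h1 := Set.ncard_le_ncard hsub hfin
  rw [Set.ncard_coe_finset, Finset.card_image_of_injective _ hinj] at h1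
  exact_mod_cast h1

/-! ### Borel–Cantelli arguments -/

section BorelCantelli

variable {Ω : Type*} [MeasurableSpace Ω] {P : Measure Ω} [IsProbabilityMeasure P]

lemma ae_eventually_notMem_of_summable {E : ℕ → Set Ω} {g : ℕ → ℝ} (hg : Summable g)
    (h : ∀ j, P.real (E j) ≤ g j) : ∀ᵐ ω ∂P, ∀ᶠ j in atTop, ω ∉ E j := by
  refine ae_eventually_notMem (ne_top_of_le_ne_top hg.tsum_ofReal_ne_top ?_)
  refine ENNReal.tsum_le_tsum fun j => ?_
  rw [← ofReal_measureReal]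
  exact ENNReal.ofReal_le_ofReal (h j)

lemma ae_frequently_mem_of_not_summable {E : ℕ → Set Ω} (hE : ∀ j, MeasurableSet (E j))
    (hind : iIndepSet E P) (h : ¬ Summable fun j => P.real (E j)) :
    ∀ᵐ ω ∂P, ∃ᶠ j in atTop, ω ∈ E j := by
  have htop : ∑' j, P (E j) = ⊤ := by
    by_contra hne
    exact h (ENNReal.summable_toReal hne)
  have h1 := measure_limsup_eq_one hE hind htop
  have h2 : MeasurableSet (limsup E atTop) := .measurableSet_limsup hE
  have h3 : ∀ᵐ ω ∂P, ω ∈ limsup E atTop := (prob_compl_eq_zero_iff h2).2 h1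
  filter_upwards [h3] with ω hω
  exact mem_limsup_iff_frequently_mem.1 hω

variable {β : ℝ} {X : ℝ≥0 → Ω → ℝ}

/-- The increments over disjoint intervals are independent, and the `j`-th one climbs by three
levels with probability of order `1 / peakExp (j + 1)`. -/
lemma IsSymmetricStableProcess.ae_frequently_climb (hX : IsSymmetricStableProcess β X P)
    (hβ : 0 < β) (hβ₂ : β < 2) :
    ∀ᵐ ω ∂P, ∃ᶠ j in atTop, 3 * peakLevel β (j + 1)
      < X (2 ^ peakExp (j + 1)) ω - X (2 ^ peakExp j) ω := by
  set τ : ℕ → ℝ≥0 := fun j => 2 ^ peakExp j with hτ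
  have hτm : Monotone τ := fun a b hab => pow_le_pow_right₀ one_le_two (peakExp_mono hab)
  have hmeas : ∀ j, Measurable fun ω => X (τ (j + 1)) ω - X (τ j) ω :=
    fun j => (hX.measurable _).sub (hX.measurable _)
  refine ae_frequently_mem_of_not_summable
    (E := fun j => {ω | 3 * peakLevel β (j + 1) < X (τ (j + 1)) ω - X (τ j) ω})
    (fun j => measurableSet_lt measurable_const (hmeas j)) ?_ ?_
  · rw [iIndepSet_iff_meas_biInter fun j => measurableSet_lt measurable_const (hmeas j)]
    intro s
    exact (hX.indep.nat hτm).measure_inter_preimage_eq_mul s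
      (sets := fun j => Set.Ioi (3 * peakLevel β (j + 1))) fun _ _ => measurableSet_Ioi
  · obtain ⟨c, hc, K, hK, h⟩ := hX.exists_le_measureReal_lt_increment hβ₂
    have hdiv : ¬ Summable fun j : ℕ => 1 / (peakExp (j + 1) : ℝ) := by
      rw [summable_nat_add_iff 1 (f := fun j : ℕ => 1 / (peakExp j : ℝ))]
      exact not_summable_one_div_peakExp
    refine fun hsum => hdiv (summable_of_isBigO_nat hsum ?_)
    refine Asymptotics.IsBigO.of_bound (8 * 3 ^ β / c) ?_
    filter_upwards [tendsto_natCast_atTop_atTop.eventually_ge_atTop K] with j hj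
    have hexp : (j : ℝ) + 1 ≤ peakExp (j + 1) := by exact_mod_cast le_peakExp (j + 1)
    have hj0 : (0 : ℝ) ≤ j := j.cast_nonneg
    have hpow : 2 * (2 : ℝ) ^ peakExp j ≤ 2 ^ peakExp (j + 1) := by
      rw [← pow_succ']
      exact pow_le_pow_right₀ one_le_two
        (le_trans (Nat.add_le_add_left (one_le_peakGap _) _) (peakExp_add_peakGap_le j))
    have hT : (0 : ℝ) < 2 ^ peakExp (j + 1) := by positivity
    have hadd : τ j + (τ (j + 1) - τ j) = τ (j + 1) := add_tsub_cancel_of_le (hτm j.le_succ)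
    have hsub : ((τ (j + 1) - τ j : ℝ≥0) : ℝ) = 2 ^ peakExp (j + 1) - 2 ^ peakExp j := by
      rw [NNReal.coe_sub (hτm j.le_succ)]; simp [hτ]
    have h3 : (1 : ℝ) ≤ 3 ^ β := Real.one_le_rpow (by norm_num) hβ.le
    have hlev : (3 * peakLevel β (j + 1)) ^ β
        = 3 ^ β * (2 * 2 ^ peakExp (j + 1) * (peakExp (j + 1) + 1)) := by
      rw [Real.mul_rpow (by norm_num) (peakLevel_pos _ _).le, peakLevel_rpow hβ]
    have h1 := h (τ j) (τ (j + 1) - τ j) (3 * peakLevel β (j + 1))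
      (mul_pos three_pos (peakLevel_pos _ _)) (by
        rw [hlev, hsub]
        have h0 : (0 : ℝ) < 2 ^ peakExp j := by positivity
        calc K * (2 ^ peakExp (j + 1) - 2 ^ peakExp j)
            ≤ (peakExp (j + 1) + 1) * (2 * 2 ^ peakExp (j + 1)) := by
              refine mul_le_mul ?_ ?_ ?_ ?_ <;> linarith
          _ = 1 * (2 * 2 ^ peakExp (j + 1) * (peakExp (j + 1) + 1)) := by ring
          _ ≤ _ := by gcongr)
    rw [hadd, hlev, hsub] at h1
    rw [Real.norm_of_nonneg (by positivity), Real.norm_of_nonneg measureReal_nonneg]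
    have h4 : (c / (8 * 3 ^ β)) * (1 / (peakExp (j + 1) : ℝ))
        ≤ c * (2 ^ peakExp (j + 1) - 2 ^ peakExp j)
          / (3 ^ β * (2 * 2 ^ peakExp (j + 1) * (peakExp (j + 1) + 1))) := by
      have hpos : (0 : ℝ) < peakExp (j + 1) := by linarith
      rw [div_mul_div_comm, mul_one, div_le_div_iff₀ (by positivity) (by positivity)]
      have h5 : (3 ^ β * (2 * 2 ^ peakExp (j + 1) * ((peakExp (j + 1) : ℝ) + 1)))
          ≤ 3 ^ β * (2 * (2 * (2 ^ peakExp (j + 1) - 2 ^ peakExp j)) * (2 * peakExp (j + 1))) := by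
        gcongr <;> linarith
      nlinarith [mul_le_mul_of_nonneg_left h5 hc.le]
    calc 1 / (peakExp (j + 1) : ℝ)
        = 8 * 3 ^ β / c * ((c / (8 * 3 ^ β)) * (1 / (peakExp (j + 1) : ℝ))) := by field_simp
      _ ≤ _ := by gcongr; exact h4.trans h1

/-- At the scale `j`, times up to `2 ^ (peakExp j - peakGap j)` are so short that a fall below
minus one level at such a time has summable probability. -/
lemma two_mul_rpow_mul_div_peakLevel_rpow_le (hβ : 0 < β) {j : ℕ} (hj : 1 ≤ j) {t : ℝ}
    (ht : t ≤ 2 ^ (peakExp j - peakGap j)) :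
    2 * 2 ^ β * t / peakLevel β j ^ β ≤ 2 ^ β * (1 / (j : ℝ) ^ 2) := by
  have hj0 : (0 : ℝ) < j := by exact_mod_cast hj
  have hexp : (j : ℝ) ≤ peakExp j := by exact_mod_cast le_peakExp j
  have hgap : (j : ℝ) ≤ 2 ^ peakGap j := by exact_mod_cast le_two_pow_peakGap j
  have hpow : (2 : ℝ) ^ peakExp j = 2 ^ (peakExp j - peakGap j) * 2 ^ peakGap j := by
    rw [← pow_add, Nat.sub_add_cancel (peakGap_le_peakExp hj)]
  have hL : (0 : ℝ) < 2 ^ (peakExp j - peakGap j) := by positivity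
  rw [peakLevel_rpow hβ, hpow]
  calc 2 * 2 ^ β * t / (2 * (2 ^ (peakExp j - peakGap j) * 2 ^ peakGap j) * (peakExp j + 1))
      ≤ 2 * 2 ^ β * 2 ^ (peakExp j - peakGap j)
          / (2 * (2 ^ (peakExp j - peakGap j) * j) * j) := by gcongr; linarith
    _ = 2 ^ β * (1 / (j : ℝ) ^ 2) := by field_simp

lemma IsSymmetricStableProcess.ae_eventually_past (hX : IsSymmetricStableProcess β X P)
    (hβ : 0 < β) :
    ∀ᵐ ω ∂P, ∀ᶠ j in atTop, -peakLevel β (j + 1) ≤ X (2 ^ peakExp j) ω := by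
  have hs : Summable fun j : ℕ => (2 : ℝ) ^ β * (1 / ((j + 1 : ℕ) : ℝ) ^ 2) :=
    ((summable_nat_add_iff 1).2 (Real.summable_one_div_nat_pow.2 one_lt_two)).mul_left _
  have h := ae_eventually_notMem_of_summable (P := P)
    (E := fun j => {ω | X (2 ^ peakExp j) ω < -peakLevel β (j + 1)}) hs fun j => by
      refine (hX.measureReal_lt_neg_le hβ _ (peakLevel_pos _ _)).trans ?_
      refine two_mul_rpow_mul_div_peakLevel_rpow_le hβ j.succ_pos ?_
      push_cast
      refine pow_le_pow_right₀ one_le_two ?_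
      exact Nat.le_sub_of_add_le (peakExp_add_peakGap_le j)
  filter_upwards [h] with ω hω
  exact hω.mono fun j hj => not_lt.1 hj

/-- Markov's inequality for the expected number of integer times of the window with a large fall
replaces a maximal inequality. -/
lemma IsSymmetricStableProcess.ae_eventually_stay (hX : IsSymmetricStableProcess β X P)
    (hβ : 0 < β) :
    ∀ᵐ ω ∂P, ∀ᶠ j in atTop, ((((Finset.range (2 ^ (peakExp j - peakGap j))).filter fun k : ℕ =>
      X (2 ^ peakExp j + k) ω - X (2 ^ peakExp j) ω < -peakLevel β j).card : ℕ) : ℝ)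
        < (2 : ℝ) ^ (peakExp j - peakGap j) / 2 := by
  have hs : Summable fun j : ℕ => 2 * ((2 : ℝ) ^ β * (1 / ((j + 1 : ℕ) : ℝ) ^ 2)) :=
    (((summable_nat_add_iff 1).2 (Real.summable_one_div_nat_pow.2 one_lt_two)).mul_left _).mul_left _
  let L : ℕ → ℕ := fun j => 2 ^ (peakExp j - peakGap j)
  let E : ℕ → ℕ → Set Ω := fun j k =>
    {ω | X (2 ^ peakExp j + k) ω - X (2 ^ peakExp j) ω < -peakLevel β j}
  classical
  have h := ae_eventually_notMem_of_summable (P := P)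
    (E := fun j => {ω | ((Finset.range (L (j + 1))).card : ℝ) / 2
      ≤ ((Finset.range (L (j + 1))).filter fun k => ω ∈ E (j + 1) k).card}) hs fun j => by
      refine measureReal_half_le_card_le (E := E (j + 1)) (Finset.range (L (j + 1)))
        (Finset.nonempty_range_iff.2 (by positivity)) (fun k _ => ?_) fun k hk => ?_
      · exact measurableSet_lt ((hX.measurable _).sub (hX.measurable _)) measurable_const
      · refine (hX.measureReal_increment_lt_neg_le hβ _ _ (peakLevel_pos _ _)).trans ?_
        refine two_mul_rpow_mul_div_peakLevel_rpow_le hβ j.succ_pos ?_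
        have := Finset.mem_range.1 hk
        exact_mod_cast this.le
  filter_upwards [h] with ω hω
  rw [← map_add_atTop_eq_nat 1, eventually_map]
  refine hω.mono fun j hj => ?_
  have hj' := not_le.1 hj
  rw [Finset.card_range] at hj'
  simp only [L, E, Set.mem_ofPred_eq] at hj'
  push_cast at hj'
  convert hj'

end BorelCantelli

theorem mainTheorem4 {Ω : Type*} [MeasurableSpace Ω] (P : Measure Ω) [IsProbabilityMeasure P]
    (β : ℝ) (hβ₀ : 0 < β) (hβ₂ : β < 2) (X : ℝ≥0 → Ω → ℝ)
    (hX : IsSymmetricStableProcess β X P) (α : ℝ) (hα₀ : 0 < α) (hα : α ≤ 1 / β) :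
    ∀ᵐ ω ∂P, macroMinkowskiDim (tallPeaks β α (fun t => X t ω)) = 1 := by
  filter_upwards [hX.ae_frequently_climb hβ₀ hβ₂, hX.ae_eventually_past hβ₀,
    hX.ae_eventually_stay hβ₀] with ω hclimb hpast hstay
  refine le_antisymm (macroMinkowskiDim_le_one _) (one_le_macroMinkowskiDim ?_)
  refine (tendsto_add_atTop_nat 1).frequently ?_
  refine (hclimb.and_eventually (hpast.and
    (((tendsto_add_atTop_nat 1).eventually hstay).and (eventually_ge_atTop 1)))).mono ?_
  rintro j ⟨hj₁, hj₂, hj₃, hj₄⟩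
  exact le_ncard_pix_tallPeaks hβ₀ hα (Nat.succ_le_succ hj₄) hj₂ hj₁ hj₃
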